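/- Let $n\ge 3$, $m\ge 2$, let $M^n$ be a nonempty smooth $n$-dimensional Riemannian manifold and $f\colon M^n\to\mathbb{R}^{n+m}$ a smooth isometric immersion with second fundamental form $\alpha_f$, normal connection $\nabla^\perp$ and shape operators $\langle A_\eta X,Y\rangle=\langle\alpha_f(X,Y),\eta\rangle$. Assume that $f$ is a Wintgen ideal submanifold, that is, at every point equality $s=\|\mathcal H_f\|^2-s^\perp$ holds in the DDVV inequality, where $s$ is the normalized scalar curvature of $M^n$, $\mathcal H_f=\frac1n\operatorname{tr}\alpha_f$ is the mean curvature vector, and $s^\perp=\|R^\perp\|/(n(n-1))$ with $R^\perp$ the normal curvature tensor. Let $\mu,\gamma_1,\gamma_2\colon M^n\to\mathbb{R}$ be the functions in the pointwise normal form of $f$: at every point there are an orthonormal tangent basis $e_1,\dots,e_n$ and an orthonormal normal basis $\eta_1,\dots,\eta_m$ such that, with respect to $e_1,\dots,e_n$, $$A_{\eta_1}=\begin{bmatrix}\mu&&\\&-\mu&\\&&0\end{bmatrix},\quad A_{\eta_2}=\begin{bmatrix}\gamma_1&\mu&\\\mu&\gamma_1&\\&&\gamma_1I_{n-2}\end{bmatrix},\quad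 A_{\eta_3}=\gamma_2I_n,\quad A_{\eta_a}=0\ \ (a\ge4)$$ (the conditions on $\eta_a$ being void for $a>m$). Suppose that $\mu\ne0$, $\gamma_1\neq 0$ and $\gamma_2=0$ at every point. Then the first normal spaces $N_1(x)=\operatorname{span}\{\alpha_f(X,Y):X,Y\in T_xM\}$ have dimension $2$ at every point, and $N_1$ is parallel in the normal connection: $\nabla^\perp_X\xi$ lies in $N_1$ for every smooth local section $\xi$ of $N_1$ and every tangent vector $X$. If moreover $f$ is locally substantial, that is, no nonempty open subset of $M^n$ is mapped by $f$ into a proper affine subspace of $\mathbb{R}^{n+m}$, then $m=2$. -/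

import Mathlib

open scoped Manifold ContDiff InnerProductSpace Bundle

noncomputable section

namespace WintgenIdeal

section Intrinsic

variable {n : ℕ} {M : Type*} [TopologicalSpace M]
  [ChartedSpace (EuclideanSpace ℝ (Fin n)) M]
  [Bundle.RiemannianBundle (fun x : M => TangentSpace (𝓡 n) x)]

/-- Partial derivative in the `i`-th coordinate direction of a function on `ℝⁿ`. -/
def partialD (i : Fin n) (h : EuclideanSpace ℝ (Fin n) → ℝ) (y : EuclideanSpace ℝ (Fin n)) : ℝ :=
  fderiv ℝ h y (EuclideanSpace.single i 1)

/-- The coordinate vector field `∂ᵢ` of the preferred chart at `p`, at the point with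
coordinates `y`. -/
def coordField (p : M) (y : EuclideanSpace ℝ (Fin n)) (i : Fin n) :
    TangentSpace (𝓡 n) ((extChartAt (𝓡 n) p).symm y) :=
  mfderiv 𝓘(ℝ, EuclideanSpace ℝ (Fin n)) (𝓡 n) (extChartAt (𝓡 n) p).symm y
    (EuclideanSpace.single i (1 : ℝ) : EuclideanSpace ℝ (Fin n))

/-- The matrix `gᵢⱼ = ⟨∂ᵢ, ∂ⱼ⟩` of the Riemannian metric in the preferred chart at `p`. -/
def metricMatrix (p : M) (y : EuclideanSpace ℝ (Fin n)) : Matrix (Fin n) (Fin n) ℝ :=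
  Matrix.of fun i j => inner ℝ (coordField p y i) (coordField p y j)

/-- The Christoffel symbols `Γᵏᵢⱼ` of the Levi-Civita connection in the preferred chart at `p`. -/
def christoffel (p : M) (k i j : Fin n) (y : EuclideanSpace ℝ (Fin n)) : ℝ :=
  (1 / 2) * ∑ l, (metricMatrix p y)⁻¹ k l *
    (partialD i (fun z => metricMatrix p z j l) y
      + partialD j (fun z => metricMatrix p z i l) y
      - partialD l (fun z => metricMatrix p z i j) y)

/-- The components of the Riemann tensor `R(X,Y)Z = ∇_X∇_Y Z - ∇_Y∇_X Z - ∇_[X,Y] Z`: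
`R(∂ᵢ,∂ⱼ)∂ₖ = ∑ₗ (riemann p l i j k) ∂ₗ`. -/
def riemann (p : M) (l i j k : Fin n) (y : EuclideanSpace ℝ (Fin n)) : ℝ :=
  partialD i (christoffel p l j k) y - partialD j (christoffel p l i k) y
    + ∑ q, (christoffel p l i q y * christoffel p q j k y
      - christoffel p l j q y * christoffel p q i k y)

/-- The Ricci tensor `Ric(∂ⱼ,∂ₖ)`, the trace of `X ↦ R(X,∂ⱼ)∂ₖ`. -/
def ricci (p : M) (j k : Fin n) (y : EuclideanSpace ℝ (Fin n)) : ℝ :=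
  ∑ i, riemann p i i j k y

/-- The normalized scalar curvature `s = (1 / (n (n - 1))) tr Ric` (equal to `1` on the unit
sphere). -/
def normalizedScalarCurvature (p : M) : ℝ :=
  (∑ j, ∑ k, (metricMatrix p (extChartAt (𝓡 n) p p))⁻¹ j k *
    ricci p j k (extChartAt (𝓡 n) p p)) / ((n : ℝ) * ((n : ℝ) - 1))

end Intrinsic

section Extrinsic

variable (n : ℕ) {M : Type*} [TopologicalSpace M]
  [ChartedSpace (EuclideanSpace ℝ (Fin n)) M]
  {V : Type*} [NormedAddCommGroup V] [InnerProductSpace ℝ V] [FiniteDimensional ℝ V]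

/-- The differential of `ξ : M → V` at `x`, as a map into `V`. -/
def diff (ξ : M → V) (x : M) : TangentSpace (𝓡 n) x →L[ℝ] V :=
  mfderiv (𝓡 n) 𝓘(ℝ, V) ξ x

/-- The normal space of `f` at `x`: the orthogonal complement of the image of the differential. -/
def normalSpace (f : M → V) (x : M) : Submodule ℝ V :=
  (LinearMap.range (diff n f x).toLinearMap)ᗮ

/-- Orthogonal projection of `V` onto the normal space of `f` at `x`. -/
def normalProj (f : M → V) (x : M) : V →L[ℝ] V :=
  (normalSpace n f x).starProjection

/-- The second fundamental form `α_f(u,v)` at `x`: the normal component of the second derivative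
of `f` in the preferred chart at `x`. (Mathlib identifies the tangent space at `x` with the
coordinate space through this chart.) -/
def sff (f : M → V) (x : M) (u v : TangentSpace (𝓡 n) x) : V :=
  normalProj n f x
    (fderiv ℝ (fderiv ℝ (f ∘ (extChartAt (𝓡 n) x).symm)) (extChartAt (𝓡 n) x x)
      (u : EuclideanSpace ℝ (Fin n)) (v : EuclideanSpace ℝ (Fin n)))

/-- The first normal space `N₁(x) = span {α_f(u,v)}`. -/
def firstNormal (f : M → V) (x : M) : Submodule ℝ V :=
  Submodule.span ℝ {w | ∃ u v : TangentSpace (𝓡 n) x, w = sff n f x u v}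

/-- The normal connection `∇^⊥_u ξ`: the normal component of the derivative of the normal field
`ξ` in the direction `u`. -/
def normalDeriv (f : M → V) (ξ : M → V) (x : M) (u : TangentSpace (𝓡 n) x) : V :=
  normalProj n f x (diff n ξ x u)

/-- The first normal spaces are parallel in the normal connection: normal derivatives of smooth
(local) sections of `N₁` lie in `N₁`. -/
def FirstNormalParallel (f : M → V) : Prop :=
  ∀ (U : Set M) (ξ : M → V), IsOpen U → ContMDiffOn (𝓡 n) 𝓘(ℝ, V) ∞ ξ U →
    (∀ x ∈ U, ξ x ∈ firstNormal n f x) →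
    ∀ x ∈ U, ∀ u : TangentSpace (𝓡 n) x, normalDeriv n f ξ x u ∈ firstNormal n f x

/-- `f` is locally substantial: no nonempty open part of the submanifold lies in a proper affine
subspace. -/
def LocallySubstantial (f : M → V) : Prop :=
  ∀ U : Set M, IsOpen U → U.Nonempty →
    ∀ A : AffineSubspace ℝ V, f '' U ⊆ (A : Set V) → A = ⊤

/-- The normal curvature tensor
`R^⊥(u,v)ξ = ∇^⊥_u ∇^⊥_v ξ - ∇^⊥_v ∇^⊥_u ξ - ∇^⊥_[u,v] ξ` at `x`. It is computed in the preferred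
chart at `x`, where `u`, `v` are extended by constant coefficients (so that the bracket vanishes)
and the normal vector `ξ` is extended to the normal field `q ↦` (projection of `ξ` onto the
normal space at `q`). -/
def normalCurvature (f : M → V) (x : M) (u v : TangentSpace (𝓡 n) x) (ξ : V) : V :=
  let P : EuclideanSpace ℝ (Fin n) → V →L[ℝ] V :=
    fun y => normalProj n f ((extChartAt (𝓡 n) x).symm y)
  let nabla : EuclideanSpace ℝ (Fin n) → (EuclideanSpace ℝ (Fin n) → V) →
      EuclideanSpace ℝ (Fin n) → V :=
    fun w ζ y => P y (fderiv ℝ ζ y w)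
  nabla u (nabla v (fun y => P y ξ)) (extChartAt (𝓡 n) x x)
    - nabla v (nabla u (fun y => P y ξ)) (extChartAt (𝓡 n) x x)

instance instFiniteDimensionalTangent (x : M) : FiniteDimensional ℝ (TangentSpace (𝓡 n) x) :=
  inferInstanceAs (FiniteDimensional ℝ (EuclideanSpace ℝ (Fin n)))

variable [Bundle.RiemannianBundle (fun x : M => TangentSpace (𝓡 n) x)]

/-- `f` is a smooth isometric immersion of the Riemannian manifold `M` into `V`. -/
def IsIsometricImmersion (f : M → V) : Prop :=
  ContMDiff (𝓡 n) 𝓘(ℝ, V) ∞ f ∧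
    ∀ (x : M) (u v : TangentSpace (𝓡 n) x), ⟪diff n f x u, diff n f x v⟫_ℝ = inner ℝ u v

/-- The mean curvature vector `(1 / n) tr α_f`. -/
def meanCurvature (f : M → V) (x : M) : V :=
  let e := stdOrthonormalBasis ℝ (TangentSpace (𝓡 n) x)
  (1 / (n : ℝ)) • ∑ i, sff n f x (e i) (e i)

/-- The normal scalar curvature `s^⊥ = ‖R^⊥‖ / (n (n - 1))`, with the full tensor norm
`‖R^⊥‖² = ∑ i j a, ‖R^⊥(eᵢ,eⱼ)ξₐ‖²` in orthonormal bases. -/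
def normalScalarCurvature (f : M → V) (x : M) : ℝ :=
  let e := stdOrthonormalBasis ℝ (TangentSpace (𝓡 n) x)
  let ζ := stdOrthonormalBasis ℝ (normalSpace n f x)
  Real.sqrt (∑ i, ∑ j, ∑ a, ‖normalCurvature n f x (e i) (e j) (ζ a : V)‖ ^ 2)
    / ((n : ℝ) * ((n : ℝ) - 1))

/-- `f` (an isometric immersion into Euclidean space) is Wintgen ideal: equality holds in the DDVV
inequality `s ≤ H² - s^⊥` at every point. -/
def IsWintgenIdeal (f : M → V) : Prop :=
  ∀ x : M, normalizedScalarCurvature (n := n) x = ‖meanCurvature n f x‖ ^ 2 - normalScalarCurvature n f x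

/-- The matrices `A_{η₁}` (`a = 0`), `A_{η₂}` (`a = 1`), `A_{η₃}` (`a = 2`), `A_{ηₐ}` (`a ≥ 3`) of
the pointwise normal form of Wintgen ideal submanifolds:
`diag(μ, -μ, 0, …, 0)`; `γ₁ I` plus `μ` in the entries `(1,2)` and `(2,1)`; `γ₂ I`; `0`. -/
def wintgenMatrix (n : ℕ) (μ γ₁ γ₂ : ℝ) (a : ℕ) : Matrix (Fin n) (Fin n) ℝ :=
  Matrix.of fun i j =>
    match a with
    | 0 => if i = j then (if i.val = 0 then μ else if i.val = 1 then -μ else 0) else 0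
    | 1 => if i = j then γ₁ else
        if (i.val = 0 ∧ j.val = 1) ∨ (i.val = 1 ∧ j.val = 0) then μ else 0
    | 2 => if i = j then γ₂ else 0
    | _ => 0

/-- `μ, γ₁, γ₂` are the coefficients of the pointwise normal form of `f` at `x`: there are
orthonormal bases `e` of the tangent space and `η` of the normal space in which the shape operators
`⟨A_{ηₐ} eᵢ, eⱼ⟩ = ⟨α_f(eᵢ,eⱼ), ηₐ⟩` are the matrices above. -/
def HasWintgenForm (m : ℕ) (f : M → V) (x : M) (μ γ₁ γ₂ : ℝ) : Prop :=
  ∃ (e : OrthonormalBasis (Fin n) ℝ (TangentSpace (𝓡 n) x))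
    (η : OrthonormalBasis (Fin m) ℝ (normalSpace n f x)),
    ∀ (a : Fin m) (i j : Fin n),
      ⟪sff n f x (e i) (e j), (η a : V)⟫_ℝ = wintgenMatrix n μ γ₁ γ₂ a i j

end Extrinsic

end WintgenIdeal

end

/-!
The theorem is a consequence of the Codazzi equation, applied to the second osculating spaces.

In a chart write `F` for the immersion and let `O y` be the span of the first and second partial
derivatives of `F` at `y`. It is the sum of the tangent space and the first normal space
(`osculating_localRep`), and the normal form gives it the constant dimension `n + 2`. The
derivative `D_X σ` of a section `σ` of such a bundle of constant rank, taken modulo `O`, depends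
only on the value of `σ` (`fderiv_section_sub_mem`), and so defines linear maps
`β_X : O → V / O`. They vanish on tangent vectors, and `β_X (D²F(Y, Z)) = D³F(X, Y, Z)` modulo `O`
is symmetric in `X` and `Y`; this is the part of the Codazzi equation normal to `N₁`. For the
matrices of the normal form with `μ ≠ 0`, `γ₁ ≠ 0`, `γ₂ = 0` and `n ≥ 3` these equations force
`β = 0` (`eq_zero_of_codazzi`), so the derivatives of sections of `O` stay in `O`
(`fderiv_section_mem_osculating`). Taking normal components, `N₁` is parallel.

A bundle of constant rank that is closed under differentiation of its sections is locally constant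
(`eventually_eq_of_fderiv_section_mem`). Hence `f` maps a neighbourhood of each point into an
affine subspace of dimension `n + 2`, and `m = 2` if `f` is locally substantial.
-/

namespace WintgenIdeal

open scoped Topology

/-! ### Bundles of subspaces of constant rank -/

section LocalProjection
variable {E V : Type*} [NormedAddCommGroup E] [NormedSpace ℝ E]
  [NormedAddCommGroup V] [NormedSpace ℝ V]

/-- Modulo `O y₀`, the derivative of a section `σ` of `O` depends linearly on the value `σ y₀`:
differentiate `σ = Pr σ`, where `Pr y` is a projection onto `O y`. -/
theorem fderiv_section_sub_mem {O : E → Submodule ℝ V} {y₀ : E} {Pr : E → V →L[ℝ] V}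
    (hPr : DifferentiableAt ℝ Pr y₀) (hmem : ∀ w, Pr y₀ w ∈ O y₀)
    (hfix : ∀ᶠ y in 𝓝 y₀, ∀ w ∈ O y, Pr y w = w) {σ : E → V} (hσ : DifferentiableAt ℝ σ y₀)
    (hσO : ∀ᶠ y in 𝓝 y₀, σ y ∈ O y) (X : E) :
    fderiv ℝ σ y₀ X - fderiv ℝ Pr y₀ X (σ y₀) ∈ O y₀ := by
  have h : σ =ᶠ[𝓝 y₀] fun y => Pr y (σ y) := by
    filter_upwards [hfix, hσO] with y h1 h2 using (h1 _ h2).symm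
  have h' : fderiv ℝ σ y₀ X = Pr y₀ (fderiv ℝ σ y₀ X) + fderiv ℝ Pr y₀ X (σ y₀) := by
    conv_lhs => rw [h.fderiv_eq, fderiv_clm_apply hPr hσ]
    simp
  rw [sub_eq_of_eq_add h']
  exact hmem _

variable [FiniteDimensional ℝ V]

/-- A bundle of subspaces of constant rank, spanned by `C¹` fields, has a `C¹` family of projections
onto its fibres near `y₀`. The projections need not be orthogonal; they are chosen with the same
kernel, which is what the last two identities say. -/
theorem exists_local_projection {ι : Type*} (g : ι → E → V) (O : E → Submodule ℝ V) (y₀ : E)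
    (hg : ∀ i, ContDiffAt ℝ 1 (g i) y₀)
    (hO : ∀ y, O y = Submodule.span ℝ (Set.range fun i => g i y))
    (hr : ∀ᶠ y in 𝓝 y₀, Module.finrank ℝ (O y) = Module.finrank ℝ (O y₀)) :
    ∃ Pr : E → V →L[ℝ] V, ContDiffAt ℝ 1 Pr y₀ ∧ ∀ᶠ y in 𝓝 y₀,
      (∀ w, Pr y w ∈ O y) ∧ (∀ w ∈ O y, Pr y w = w) ∧
      (∀ w, Pr y (Pr y₀ w) = Pr y w) ∧ (∀ w, Pr y₀ (Pr y w) = Pr y₀ w) := by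
  obtain ⟨κ, a, -, hspan, hli⟩ := exists_linearIndependent' ℝ (fun i => g i y₀)
  have : Finite κ := hli.finite
  cases nonempty_fintype κ
  -- `B y c` is the combination with coefficients `c` of the fields that form a basis at `y₀`.
  let B : E → (κ → ℝ) →L[ℝ] V := fun y =>
    ∑ k, (ContinuousLinearMap.proj (R := ℝ) (φ := fun _ : κ => ℝ) k).smulRight (g (a k) y)
  have hBapp : ∀ y c, B y c = ∑ k, c k • g (a k) y := fun y c => by
    simp [B]
  have hBcd : ContDiffAt ℝ 1 B y₀ := by
    refine ContDiffAt.sum fun k _ => ?_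
    exact contDiffAt_const.smulRight (hg (a k))
  have hBmem : ∀ y c, B y c ∈ O y := fun y c => by
    rw [hBapp, hO]
    exact Submodule.sum_mem _ fun k _ => Submodule.smul_mem _ _
      (Submodule.subset_span ⟨a k, rfl⟩)
  have hBinj : Function.Injective (B y₀) := by
    rw [← ContinuousLinearMap.coe_coe, ← LinearMap.ker_eq_bot, LinearMap.ker_eq_bot']
    intro c hc
    funext k
    exact Fintype.linearIndependent_iff.1 hli c (by simpa [hBapp] using hc) k
  have hBrank : Module.finrank ℝ (O y₀) = Fintype.card κ := by
    rw [hO, ← hspan]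
    exact finrank_span_eq_card hli
  obtain ⟨L', hL'⟩ := (B y₀).toLinearMap.exists_leftInverse_of_injective
    (LinearMap.ker_eq_bot.2 hBinj)
  let L : V →L[ℝ] (κ → ℝ) := LinearMap.toContinuousLinearMap L'
  have hL : ∀ c, L (B y₀ c) = c := fun c => LinearMap.congr_fun hL' c
  let A : E → (κ → ℝ) →L[ℝ] (κ → ℝ) := fun y => L ∘L B y
  have hA₀ : A y₀ = 1 := by ext1 c; exact hL c
  have hAcd : ContDiffAt ℝ 1 A y₀ := contDiffAt_const.clm_comp hBcd
  have hAunit : ∀ᶠ y in 𝓝 y₀, IsUnit (A y) :=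
    hAcd.continuousAt.eventually
      (Units.isOpen.mem_nhds (show IsUnit (A y₀) by rw [hA₀]; exact isUnit_one))
  have hinv : ContDiffAt ℝ 1 (fun y => Ring.inverse (A y)) y₀ := by
    have h1 := contDiffAt_ringInverse ℝ (n := 1) (1 : ((κ → ℝ) →L[ℝ] (κ → ℝ))ˣ)
    rw [Units.val_one, ← hA₀] at h1
    exact h1.comp y₀ hAcd
  -- `Pr y` is `B y` composed with the left inverse `(L ∘ B y)⁻¹ ∘ L` of `B y`.
  let Pr : E → V →L[ℝ] V := fun y => B y ∘L (Ring.inverse (A y) ∘L L)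
  have hPr : ∀ y w, Pr y w = B y (Ring.inverse (A y) (L w)) := fun _ _ => rfl
  -- All these projections have the same kernel, namely that of `L`.
  have hLPr : ∀ y, IsUnit (A y) → ∀ w, L (Pr y w) = L w := fun y hy w =>
    congrArg (fun T : (κ → ℝ) →L[ℝ] (κ → ℝ) => T (L w)) (Ring.mul_inverse_cancel _ hy)
  refine ⟨Pr, hBcd.clm_comp (hinv.clm_comp contDiffAt_const), ?_⟩
  filter_upwards [hAunit, hr] with y hy hry
  have hinvA : ∀ c, Ring.inverse (A y) (L (B y c)) = c := fun c =>
    congrArg (fun T : (κ → ℝ) →L[ℝ] (κ → ℝ) => T c) (Ring.inverse_mul_cancel _ hy)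
  have hrange : LinearMap.range (B y).toLinearMap = O y := by
    refine Submodule.eq_of_le_of_finrank_eq ?_ ?_
    · rintro _ ⟨c, rfl⟩; exact hBmem y c
    · have hinj : Function.Injective (B y).toLinearMap :=
        Function.LeftInverse.injective (g := fun v => Ring.inverse (A y) (L v)) hinvA
      rw [LinearMap.finrank_range_of_inj hinj, hry, hBrank, Module.finrank_fintype_fun_eq_card]
  refine ⟨fun w => hBmem y _, fun w hw => ?_, fun w => ?_, fun w => ?_⟩
  · rw [← hrange] at hw
    obtain ⟨c, rfl⟩ := hw
    exact congrArg (B y) (hinvA c)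
  · rw [hPr y, hLPr y₀ hAunit.self_of_nhds, ← hPr]
  · rw [hPr y₀, hLPr y hy, ← hPr]

/-- A bundle of subspaces of constant rank that is closed under differentiation of its sections is
locally constant: the projections onto the fibres along a fixed kernel have zero derivative, since
the derivative takes its values both in the fibre and in the kernel. -/
theorem eventually_eq_of_fderiv_section_mem {ι : Type*} (g : ι → E → V) (O : E → Submodule ℝ V)
    (y₀ : E) (hg : ∀ i, ContDiffAt ℝ 1 (g i) y₀)
    (hO : ∀ y, O y = Submodule.span ℝ (Set.range fun i => g i y))
    (hr : ∀ᶠ y in 𝓝 y₀, Module.finrank ℝ (O y) = Module.finrank ℝ (O y₀))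
    (hpar : ∀ᶠ y in 𝓝 y₀, ∀ σ : E → V, DifferentiableAt ℝ σ y → (∀ᶠ z in 𝓝 y, σ z ∈ O z) →
      ∀ X, fderiv ℝ σ y X ∈ O y) :
    ∀ᶠ y in 𝓝 y₀, O y = O y₀ := by
  obtain ⟨Pr, hcd, hPr⟩ := exists_local_projection g O y₀ hg hO hr
  have hev := (hcd.eventually (by simp)).and (hPr.and hpar)
  obtain ⟨ε, hε, hball⟩ := Metric.eventually_nhds_iff_ball.1 hev.eventually_nhds
  have hzero : ∀ y ∈ Metric.ball y₀ ε, fderiv ℝ Pr y = 0 := by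
    intro y hy
    have hy' := hball y hy
    obtain ⟨hcy, ⟨-, hfix, hk1, -⟩, hpy⟩ := hy'.self_of_nhds
    have hdy : DifferentiableAt ℝ Pr y := hcy.differentiableAt (by simp)
    ext X w
    -- The derivative of the section `z ↦ Pr z w` lies in `O y`, and in the common kernel.
    have hd : HasFDerivAt (fun z => Pr z w) ((fderiv ℝ Pr y).flip w) y := by
      simpa using hdy.hasFDerivAt.clm_apply (hasFDerivAt_const w y)
    have hmem : fderiv ℝ Pr y X w ∈ O y := by
      have := hpy (fun z => Pr z w) hd.differentiableAt (hy'.mono fun z hz => hz.2.1.1 w) X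
      rwa [hd.fderiv] at this
    have hker : Pr y₀ (fderiv ℝ Pr y X w) = 0 := by
      have hc : (fun z => Pr y₀ (Pr z w)) =ᶠ[𝓝 y] fun _ => Pr y₀ w :=
        hy'.mono fun z hz => hz.2.1.2.2.2 w
      have := ((Pr y₀).hasFDerivAt.comp y hd).congr_of_eventuallyEq hc.symm
      have := congrArg (fun T : E →L[ℝ] V => T X) (this.unique (hasFDerivAt_const _ y))
      simpa using this
    rw [← hfix _ hmem, ← hk1, hker]
    simp
  have hconst : ∀ y ∈ Metric.ball y₀ ε, Pr y = Pr y₀ := fun y hy =>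
    Metric.isOpen_ball.is_const_of_fderiv_eq_zero (convex_ball y₀ ε).isPreconnected
      (fun z hz => ((hball z hz).self_of_nhds.1.differentiableAt
        (by simp)).differentiableWithinAt) hzero hy
      (Metric.mem_ball_self hε)
  filter_upwards [Metric.ball_mem_nhds y₀ hε, hPr] with y hy hy'
  obtain ⟨hm, hf, -⟩ := hy'
  obtain ⟨hm₀, hf₀, -⟩ := hPr.self_of_nhds
  rw [hconst y hy] at hm hf
  exact le_antisymm (fun w hw => hf w hw ▸ hm₀ w) (fun w hw => hf₀ w hw ▸ hm w)

end LocalProjection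

/-! ### Osculating spaces and the Codazzi equation -/

/-- The algebraic core of the parallelism of `N₁`: the vectors `a i` and `b i` stand for the
components normal to `N₁` of the derivatives of `η₁` and `η₂` in the direction `e i`, and `h` is the
part of the Codazzi equation normal to `N₁`. A direction with index at least `2` exists by `hn`. -/
theorem eq_zero_of_codazzi {W : Type*} [AddCommGroup W] [Module ℝ W] {n : ℕ} (hn : 3 ≤ n)
    {μ γ : ℝ} (hμ : μ ≠ 0) (hγ : γ ≠ 0) (a b : Fin n → W)
    (h : ∀ i j k, wintgenMatrix n μ γ 0 0 j k • a i + wintgenMatrix n μ γ 0 1 j k • b i =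
      wintgenMatrix n μ γ 0 0 i k • a j + wintgenMatrix n μ γ 0 1 i k • b j) :
    (∀ i, a i = 0) ∧ ∀ i, b i = 0 := by
  have key : ∀ i : Fin n, 2 ≤ i.val → a i = 0 ∧ b i = 0 := by
    intro i hi
    have h0 : i ≠ ⟨0, by omega⟩ := fun hc => by rw [hc] at hi; simp at hi
    have h1 : i ≠ ⟨1, by omega⟩ := fun hc => by rw [hc] at hi; simp at hi
    have h0' : i.val ≠ 0 := by omega
    have h1' : i.val ≠ 1 := by omega
    have hb : b i = 0 := by
      have := h i ⟨0, by omega⟩ ⟨1, by omega⟩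
      simpa [wintgenMatrix, h1, h0', h1', hμ] using this
    refine ⟨?_, hb⟩
    have := h i ⟨0, by omega⟩ ⟨0, by omega⟩
    simpa [wintgenMatrix, h0, h0', h1', hμ, hb] using this
  have hb01 : ∀ j : Fin n, j.val < 2 → b j = 0 := by
    intro j hj
    have h2 : j ≠ ⟨2, by omega⟩ := fun hc => by rw [hc] at hj; simp at hj
    have := h j ⟨2, by omega⟩ ⟨2, by omega⟩
    obtain ⟨ha', hb'⟩ := key ⟨2, by omega⟩ le_rfl
    simpa [wintgenMatrix, h2, hγ, ha', hb'] using this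
  have hb : ∀ j, b j = 0 := fun j =>
    (lt_or_ge j.val 2).elim (hb01 j) fun hj => (key j hj).2
  refine ⟨fun j => ?_, hb⟩
  rcases lt_or_ge j.val 2 with hj | hj
  · have ha1 : a ⟨1, by omega⟩ = 0 := by
      have := h ⟨0, by omega⟩ ⟨1, by omega⟩ ⟨0, by omega⟩
      simpa [wintgenMatrix, hμ, hb] using this.symm
    have ha0 : a ⟨0, by omega⟩ = 0 := by
      have := h ⟨0, by omega⟩ ⟨1, by omega⟩ ⟨1, by omega⟩
      simpa [wintgenMatrix, hμ, hb] using this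
    obtain ⟨j, hjn⟩ := j
    have : j = 0 ∨ j = 1 := by simp at hj; omega
    rcases this with rfl | rfl
    · exact ha0
    · exact ha1
  · exact (key j hj).1

section Osculating
variable {E V : Type*} [NormedAddCommGroup E] [NormedSpace ℝ E]
  [NormedAddCommGroup V] [NormedSpace ℝ V]

/-- The second osculating space of the parametrized submanifold `F` at `y`: the span of the first
and second partial derivatives. -/
noncomputable def osculating (F : E → V) (y : E) : Submodule ℝ V :=
  LinearMap.range (fderiv ℝ F y).toLinearMap ⊔
    Submodule.span ℝ {w | ∃ u v, w = fderiv ℝ (fderiv ℝ F) y u v}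

/-- The vector fields along `F` that span the second osculating spaces. -/
noncomputable def osculatingField (F : E → V) : E ⊕ E × E → E → V :=
  Sum.elim (fun u y => fderiv ℝ F y u) fun p y => fderiv ℝ (fderiv ℝ F) y p.1 p.2

theorem osculating_eq_span (F : E → V) (y : E) :
    osculating F y = Submodule.span ℝ (Set.range fun i => osculatingField F i y) := by
  have : (Set.range fun i => osculatingField F i y) =
      Set.range (fderiv ℝ F y) ∪ {w | ∃ u v, w = fderiv ℝ (fderiv ℝ F) y u v} := by
    ext w
    simp [osculatingField, eq_comm]
  rw [this, Submodule.span_union, osculating]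
  congr 1
  exact (Submodule.span_eq (LinearMap.range (fderiv ℝ F y).toLinearMap)).symm

theorem fderiv_mem_osculating (F : E → V) (y u : E) : fderiv ℝ F y u ∈ osculating F y :=
  Submodule.mem_sup_left ⟨u, rfl⟩

theorem fderiv_fderiv_mem_osculating (F : E → V) (y u v : E) :
    fderiv ℝ (fderiv ℝ F) y u v ∈ osculating F y :=
  Submodule.mem_sup_right (Submodule.subset_span ⟨u, v, rfl⟩)

theorem contDiffAt_osculatingField {F : E → V} {y : E} (hF : ContDiffAt ℝ ∞ F y)
    (i : E ⊕ E × E) : ContDiffAt ℝ ∞ (osculatingField F i) y := by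
  have h1 : ContDiffAt ℝ ∞ (fderiv ℝ F) y := hF.fderiv_right (by simp)
  have h2 : ContDiffAt ℝ ∞ (fderiv ℝ (fderiv ℝ F)) y := h1.fderiv_right (by simp)
  rcases i with u | ⟨u, v⟩
  · exact h1.clm_apply contDiffAt_const
  · exact (h2.clm_apply contDiffAt_const).clm_apply contDiffAt_const

theorem third_derivative_symmetric {F : E → V} {y : E} (hF : ContDiffAt ℝ ∞ F y) (X Y Z : E) :
    fderiv ℝ (fun z => fderiv ℝ (fderiv ℝ F) z Y Z) y X =
      fderiv ℝ (fun z => fderiv ℝ (fderiv ℝ F) z X Z) y Y := by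
  have h1 : ContDiffAt ℝ ∞ (fderiv ℝ F) y := hF.fderiv_right (by simp)
  have hG : ContDiffAt ℝ ∞ (fun z => fderiv ℝ F z Z) y := h1.clm_apply contDiffAt_const
  have hfd : ∀ᶠ z in 𝓝 y, ∀ Y, fderiv ℝ (fun z => fderiv ℝ F z Z) z Y =
      fderiv ℝ (fderiv ℝ F) z Y Z := by
    have : ContDiffAt ℝ 1 (fderiv ℝ F) y := h1.of_le (by simp)
    filter_upwards [this.eventually (by simp)] with z hz Y
    rw [fderiv_clm_apply (hz.differentiableAt (by simp)) (differentiableAt_const _)]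
    simp
  have hGd : DifferentiableAt ℝ (fderiv ℝ fun z => fderiv ℝ F z Z) y :=
    (hG.fderiv_right (m := ∞) (by simp)).differentiableAt (by simp)
  have hsnd : ∀ X Y, fderiv ℝ (fun z => fderiv ℝ (fderiv ℝ F) z Y Z) y X =
      fderiv ℝ (fderiv ℝ fun z => fderiv ℝ F z Z) y X Y := by
    intro X Y
    have : (fun z => fderiv ℝ (fderiv ℝ F) z Y Z) =ᶠ[𝓝 y]
        fun z => fderiv ℝ (fun z => fderiv ℝ F z Z) z Y := hfd.mono fun z hz => (hz Y).symm
    rw [this.fderiv_eq, fderiv_clm_apply hGd (differentiableAt_const _)]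
    simp
  rw [hsnd, hsnd]
  exact (hG.isSymmSndFDerivAt (by
    rw [minSmoothness_of_isRCLikeNormedField]; exact WithTop.coe_le_coe.2 le_top)).eq X Y

/-- The second derivatives of `F` at `y` are, modulo the tangent space and with respect to a
suitable basis `e`, those of the normal form with `μ ≠ 0`, `γ₁ ≠ 0` and `γ₂ = 0`. No metric is
involved: `e` and `η₁`, `η₂` are not required to be orthonormal. -/
def HasWintgenHessian (n : ℕ) (F : E → V) (y : E) : Prop :=
  ∃ (μ γ : ℝ) (e : Module.Basis (Fin n) ℝ E) (η₁ η₂ : V), μ ≠ 0 ∧ γ ≠ 0 ∧ ∀ i j,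
    fderiv ℝ (fderiv ℝ F) y (e i) (e j) -
      (wintgenMatrix n μ γ 0 0 i j • η₁ + wintgenMatrix n μ γ 0 1 i j • η₂) ∈
        LinearMap.range (fderiv ℝ F y).toLinearMap

variable [FiniteDimensional ℝ V]

/-- Derivatives of sections of the second osculating bundle are sections of it, provided that it has
constant rank and the second derivative has the normal form at the point considered. -/
theorem fderiv_section_mem_osculating {n : ℕ} (hn : 3 ≤ n) {F : E → V} {y : E}
    (hF : ContDiffAt ℝ ∞ F y)
    (hr : ∀ᶠ z in 𝓝 y, Module.finrank ℝ (osculating F z) = Module.finrank ℝ (osculating F y))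
    (hform : HasWintgenHessian n F y) {σ : E → V} (hσ : DifferentiableAt ℝ σ y)
    (hσO : ∀ᶠ z in 𝓝 y, σ z ∈ osculating F z) (X : E) :
    fderiv ℝ σ y X ∈ osculating F y := by
  obtain ⟨Pr, hcd, hPr⟩ := exists_local_projection (osculatingField F) (osculating F) y
    (fun i => (contDiffAt_osculatingField hF i).of_le (by simp)) (osculating_eq_span F) hr
  have hsec : ∀ {τ : E → V}, DifferentiableAt ℝ τ y → (∀ᶠ z in 𝓝 y, τ z ∈ osculating F z) →
      ∀ X, (osculating F y).mkQ (fderiv ℝ τ y X) =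
        (osculating F y).mkQ (fderiv ℝ Pr y X (τ y)) := fun hτ hτO X =>
    (Submodule.Quotient.eq _).2 (fderiv_section_sub_mem (hcd.differentiableAt (by simp))
      hPr.self_of_nhds.1 (hPr.mono fun z hz => hz.2.1) hτ hτO X)
  -- `β X` is the derivative of sections in the direction `X`, modulo the osculating space.
  let β : E → V →ₗ[ℝ] V ⧸ osculating F y := fun X =>
    (osculating F y).mkQ ∘ₗ (fderiv ℝ Pr y X).toLinearMap
  have hβT : ∀ X u, β X (fderiv ℝ F y u) = 0 := fun X u => by
    have h1 : DifferentiableAt ℝ (fun z => fderiv ℝ F z u) y :=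
      (contDiffAt_osculatingField hF (Sum.inl u)).differentiableAt (by simp)
    have h := hsec h1 (.of_forall fun z => fderiv_mem_osculating F z u) X
    refine h.symm.trans ((Submodule.Quotient.mk_eq_zero _).2 ?_)
    have hd : DifferentiableAt ℝ (fderiv ℝ F) y :=
      (hF.fderiv_right (m := ∞) (by simp)).differentiableAt (by simp)
    rw [fderiv_clm_apply hd (differentiableAt_const _)]
    simpa using fderiv_fderiv_mem_osculating F y X u
  -- The Codazzi equation.
  have hβsymm : ∀ X Y Z, β X (fderiv ℝ (fderiv ℝ F) y Y Z) =
      β Y (fderiv ℝ (fderiv ℝ F) y X Z) := fun X Y Z => by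
    have hd : ∀ Y, DifferentiableAt ℝ (fun z => fderiv ℝ (fderiv ℝ F) z Y Z) y := fun Y =>
      (contDiffAt_osculatingField hF (Sum.inr (Y, Z))).differentiableAt (by simp)
    have h := fun X Y => hsec (hd Y) (.of_forall fun z => fderiv_fderiv_mem_osculating F z Y Z) X
    refine (h X Y).symm.trans (Eq.trans ?_ (h Y X))
    rw [third_derivative_symmetric hF]
  obtain ⟨μ, γ, e, η₁, η₂, hμ, hγ, hH⟩ := hform
  have hβH : ∀ X i j, β X (fderiv ℝ (fderiv ℝ F) y (e i) (e j)) =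
      wintgenMatrix n μ γ 0 0 i j • β X η₁ + wintgenMatrix n μ γ 0 1 i j • β X η₂ := by
    intro X i j
    obtain ⟨u, hu⟩ := hH i j
    have hu' : fderiv ℝ F y u = _ := hu
    have := hβT X u
    rw [hu', map_sub, sub_eq_zero] at this
    simpa using this
  obtain ⟨ha, hb⟩ := eq_zero_of_codazzi hn hμ hγ (fun i => β (e i) η₁) (fun i => β (e i) η₂)
    fun i j k => by rw [← hβH, ← hβH, hβsymm]
  have hlin : ∀ v, (∀ i, β (e i) v = 0) → ∀ X, β X v = 0 := by
    intro v hv X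
    let βv : E →ₗ[ℝ] V ⧸ osculating F y :=
      (osculating F y).mkQ ∘ₗ ((fderiv ℝ Pr y).flip v).toLinearMap
    have : βv = 0 := e.ext hv
    exact LinearMap.congr_fun this X
  have hβ : ∀ v ∈ osculating F y, β X v = 0 := by
    suffices h : osculating F y ≤ LinearMap.ker (β X) from fun v hv => h hv
    refine sup_le ?_ (Submodule.span_le.2 ?_)
    · rintro _ ⟨u, rfl⟩
      exact hβT X u
    · rintro _ ⟨u, v, rfl⟩
      let D : E →ₗ[ℝ] E →ₗ[ℝ] V ⧸ osculating F y :=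
        ((ContinuousLinearMap.coeLM ℝ).comp (fderiv ℝ (fderiv ℝ F) y).toLinearMap).compr₂ (β X)
      have : D = 0 := e.ext fun i => e.ext fun j => by
        refine (hβH X i j).trans ?_
        rw [hlin _ ha, hlin _ hb]
        simp
      exact LinearMap.congr_fun (LinearMap.congr_fun this u) v
  exact (Submodule.Quotient.mk_eq_zero _).1
    ((hsec hσ hσO X).trans (hβ _ hσO.self_of_nhds))

theorem eventually_osculating_eq {n : ℕ} (hn : 3 ≤ n) {F : E → V} {y : E}
    (h : ∀ᶠ z in 𝓝 y, ContDiffAt ℝ ∞ F z ∧ HasWintgenHessian n F z ∧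
      Module.finrank ℝ (osculating F z) = Module.finrank ℝ (osculating F y)) :
    ∀ᶠ z in 𝓝 y, osculating F z = osculating F y := by
  refine eventually_eq_of_fderiv_section_mem (osculatingField F) (osculating F) y
    (fun i => (contDiffAt_osculatingField h.self_of_nhds.1 i).of_le (by simp))
    (osculating_eq_span F) (h.mono fun z hz => hz.2.2) ?_
  filter_upwards [h.eventually_nhds] with z hz σ hσ hσO X
  obtain ⟨hFz, hHz, hrz⟩ := hz.self_of_nhds
  exact fderiv_section_mem_osculating hn hFz (hz.mono fun w hw => hw.2.2.trans hrz.symm) hHz hσ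
    hσO X

/-- A map whose second osculating spaces are constant stays in an affine space with that direction,
as its component transverse to the constant space has zero derivative. -/
theorem eventually_sub_mem_of_osculating_eq {F : E → V} {y : E}
    (hF : ∀ᶠ z in 𝓝 y, DifferentiableAt ℝ F z)
    (h : ∀ᶠ z in 𝓝 y, osculating F z = osculating F y) :
    ∀ᶠ z in 𝓝 y, F z - F y ∈ osculating F y := by
  obtain ⟨p, hp⟩ := (osculating F y).mkQ.exists_rightInverse_of_surjective
    (Submodule.range_mkQ _)
  -- A continuous linear map with kernel `osculating F y`.
  let Q : V →L[ℝ] V := LinearMap.toContinuousLinearMap (p ∘ₗ (osculating F y).mkQ)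
  have hQ : ∀ w, Q w = 0 ↔ w ∈ osculating F y := by
    intro w
    have hpinj : Function.Injective p :=
      Function.LeftInverse.injective (g := (osculating F y).mkQ) (LinearMap.congr_fun hp)
    rw [← Submodule.Quotient.mk_eq_zero]
    exact map_eq_zero_iff p hpinj
  obtain ⟨ε, hε, hball⟩ := Metric.eventually_nhds_iff_ball.1 (hF.and h)
  have hd : ∀ z ∈ Metric.ball y ε, HasFDerivAt (fun z => Q (F z)) (Q ∘L fderiv ℝ F z) z :=
    fun z hz => Q.hasFDerivAt.comp z (hball z hz).1.hasFDerivAt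
  filter_upwards [Metric.ball_mem_nhds y hε] with z hz
  rw [← hQ, map_sub, sub_eq_zero]
  refine Metric.isOpen_ball.is_const_of_fderiv_eq_zero (𝕜 := ℝ) (f := fun z => Q (F z))
    (convex_ball y ε).isPreconnected
    (fun z hz => (hd z hz).differentiableAt.differentiableWithinAt) (fun z hz => ?_) hz
    (Metric.mem_ball_self hε)
  rw [(hd z hz).fderiv]
  ext X
  exact (hQ _).2 ((hball z hz).2 ▸ fderiv_mem_osculating F z X)

end Osculating

/-! ### Changes of coordinates -/

section Reparametrization
variable {E V : Type*} [NormedAddCommGroup E] [NormedSpace ℝ E]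
  [NormedAddCommGroup V] [NormedSpace ℝ V]

/-- The second derivative of a reparametrization is that of the original map up to a tangent
vector. -/
theorem fderiv_fderiv_comp_apply {F G : E → V} {φ : E → E} {y : E}
    (hG : ContDiffAt ℝ ∞ G (φ y)) (hφ : ContDiffAt ℝ ∞ φ y) (hF : F =ᶠ[𝓝 y] G ∘ φ) (u v : E) :
    fderiv ℝ (fderiv ℝ F) y u v =
      fderiv ℝ (fderiv ℝ G) (φ y) (fderiv ℝ φ y u) (fderiv ℝ φ y v) +
        fderiv ℝ G (φ y) (fderiv ℝ (fderiv ℝ φ) y u v) := by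
  have hGd : DifferentiableAt ℝ (fderiv ℝ G) (φ y) :=
    (hG.fderiv_right (m := ∞) (by simp)).differentiableAt (by simp)
  have hφd : DifferentiableAt ℝ (fderiv ℝ φ) y :=
    (hφ.fderiv_right (m := ∞) (by simp)).differentiableAt (by simp)
  have h1 : fderiv ℝ F =ᶠ[𝓝 y] fun z => (fderiv ℝ G (φ z)).comp (fderiv ℝ φ z) := by
    have hG1 : ∀ᶠ z in 𝓝 y, ContDiffAt ℝ 1 G (φ z) :=
      hφ.continuousAt.eventually ((hG.of_le (m := 1) (by simp)).eventually (by simp))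
    filter_upwards [hF.eventuallyEq_nhds, hG1,
      (hφ.of_le (m := 1) (by simp)).eventually (by simp)] with z hz h2 h3
    rw [hz.fderiv_eq, fderiv_comp z (h2.differentiableAt (by simp))
      (h3.differentiableAt (by simp))]
  have h2 : HasFDerivAt (fun z => fderiv ℝ G (φ z))
      ((fderiv ℝ (fderiv ℝ G) (φ y)).comp (fderiv ℝ φ y)) y :=
    hGd.hasFDerivAt.comp y (hφ.differentiableAt (by simp)).hasFDerivAt
  rw [h1.fderiv_eq, (h2.clm_comp hφd.hasFDerivAt).fderiv]
  simp [add_comm]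

theorem range_fderiv_comp {F G : E → V} {φ : E → E} {y : E}
    (hG : ContDiffAt ℝ ∞ G (φ y)) (hφ : ContDiffAt ℝ ∞ φ y) (hF : F =ᶠ[𝓝 y] G ∘ φ)
    (A : E ≃L[ℝ] E) (hA : fderiv ℝ φ y = A) :
    LinearMap.range (fderiv ℝ F y).toLinearMap =
      LinearMap.range (fderiv ℝ G (φ y)).toLinearMap := by
  have h : ∀ u, fderiv ℝ F y u = fderiv ℝ G (φ y) (A u) := fun u => by
    rw [hF.fderiv_eq, fderiv_comp y (hG.differentiableAt (by simp))
      (hφ.differentiableAt (by simp)), hA]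
    rfl
  ext w
  constructor
  · rintro ⟨u, rfl⟩
    exact ⟨A u, (h u).symm⟩
  · rintro ⟨u, rfl⟩
    exact ⟨A.symm u, (h _).trans (by simp)⟩

theorem osculating_comp {F G : E → V} {φ : E → E} {y : E}
    (hG : ContDiffAt ℝ ∞ G (φ y)) (hφ : ContDiffAt ℝ ∞ φ y) (hF : F =ᶠ[𝓝 y] G ∘ φ)
    (A : E ≃L[ℝ] E) (hA : fderiv ℝ φ y = A) :
    osculating F y = osculating G (φ y) := by
  have h2 := fderiv_fderiv_comp_apply hG hφ hF
  have hr := range_fderiv_comp hG hφ hF A hA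
  refine le_antisymm (sup_le ?_ (Submodule.span_le.2 ?_)) (sup_le ?_ (Submodule.span_le.2 ?_))
  · rw [hr]; exact le_sup_left
  · rintro _ ⟨u, v, rfl⟩
    rw [h2]
    exact add_mem (fderiv_fderiv_mem_osculating _ _ _ _) (fderiv_mem_osculating _ _ _)
  · rw [← hr]; exact le_sup_left
  · rintro _ ⟨u, v, rfl⟩
    have := h2 (A.symm u) (A.symm v)
    simp only [hA, ContinuousLinearEquiv.coe_coe, ContinuousLinearEquiv.apply_symm_apply] at this
    rw [eq_sub_of_add_eq this.symm]
    refine sub_mem (fderiv_fderiv_mem_osculating _ _ _ _) (Submodule.mem_sup_left ?_)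
    rw [hr]
    exact ⟨_, rfl⟩

theorem HasWintgenHessian.comp {n : ℕ} {F G : E → V} {φ : E → E} {y : E}
    (hG : ContDiffAt ℝ ∞ G (φ y)) (hφ : ContDiffAt ℝ ∞ φ y) (hF : F =ᶠ[𝓝 y] G ∘ φ)
    (A : E ≃L[ℝ] E) (hA : fderiv ℝ φ y = A) (h : HasWintgenHessian n G (φ y)) :
    HasWintgenHessian n F y := by
  obtain ⟨μ, γ, e, η₁, η₂, hμ, hγ, he⟩ := h
  refine ⟨μ, γ, e.map A.symm.toLinearEquiv, η₁, η₂, hμ, hγ, fun i j => ?_⟩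
  have hi : ∀ i, fderiv ℝ φ y (e.map A.symm.toLinearEquiv i) = e i := fun i => by simp [hA]
  rw [fderiv_fderiv_comp_apply hG hφ hF, hi, hi, add_sub_right_comm,
    range_fderiv_comp hG hφ hF A hA]
  exact add_mem (he i j) ⟨_, rfl⟩

end Reparametrization

section Charts
variable {n : ℕ} {M : Type*} [TopologicalSpace M] [ChartedSpace (EuclideanSpace ℝ (Fin n)) M]
  {V : Type*}

/-- The map `f` in the coordinates of the preferred chart at `p`. -/
noncomputable def localRep (f : M → V) (p : M) : EuclideanSpace ℝ (Fin n) → V :=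
  f ∘ (extChartAt (𝓡 n) p).symm

theorem contMDiffAt_extChartAt_symm [IsManifold (𝓡 n) ∞ M] {p : M}
    {y : EuclideanSpace ℝ (Fin n)} (hy : y ∈ (extChartAt (𝓡 n) p).target) :
    ContMDiffAt 𝓘(ℝ, EuclideanSpace ℝ (Fin n)) (𝓡 n) ∞ (extChartAt (𝓡 n) p).symm y :=
  (contMDiffOn_extChartAt_symm p).contMDiffAt ((isOpen_extChartAt_target p).mem_nhds hy)

/-- The change `φ` from the preferred chart at `p` to the one at the point `q` with coordinates `y`,
with its invertible derivative. -/
theorem exists_coordinate_change [IsManifold (𝓡 n) ∞ M] (p : M)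
    {y : EuclideanSpace ℝ (Fin n)} (hy : y ∈ (extChartAt (𝓡 n) p).target) (q : M)
    (hq : q = (extChartAt (𝓡 n) p).symm y) :
    ∃ (φ : EuclideanSpace ℝ (Fin n) → EuclideanSpace ℝ (Fin n))
      (A : EuclideanSpace ℝ (Fin n) ≃L[ℝ] EuclideanSpace ℝ (Fin n)),
      φ y = extChartAt (𝓡 n) q q ∧ ContDiffAt ℝ ∞ φ y ∧ fderiv ℝ φ y = A ∧
      ∀ f : M → V, localRep f p =ᶠ[𝓝 y] localRep f q ∘ φ := by
  have hsymm := contMDiffAt_extChartAt_symm hy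
  have hqp : q ∈ (extChartAt (𝓡 n) p).source := hq ▸ (extChartAt (𝓡 n) p).map_target hy
  have hyq : extChartAt (𝓡 n) p q = y := hq ▸ (extChartAt (𝓡 n) p).right_inv hy
  let φ := extChartAt (𝓡 n) q ∘ (extChartAt (𝓡 n) p).symm
  let ψ := extChartAt (𝓡 n) p ∘ (extChartAt (𝓡 n) q).symm
  have hφy : φ y = extChartAt (𝓡 n) q q := by simp [φ, hq]
  have hψy : ψ (φ y) = y := by  simp only [hφy, ψ, Function.comp_apply, extChartAt_to_inv, hyq]
  have hφ : ContDiffAt ℝ ∞ φ y := by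
    refine ContMDiffAt.contDiffAt (ContMDiffAt.comp y ?_ hsymm)
    rw [← hq]
    exact contMDiffAt_extChartAt
  have hψ : ContDiffAt ℝ ∞ ψ (φ y) := by
    rw [hφy]
    refine ContMDiffAt.contDiffAt (ContMDiffAt.comp _ ?_
      (contMDiffAt_extChartAt_symm (mem_extChartAt_target q)))
    rw [extChartAt_to_inv]
    exact contMDiffAt_extChartAt' (by simpa using hqp)
  have hsrc : ∀ᶠ z in 𝓝 y, (extChartAt (𝓡 n) p).symm z ∈ (extChartAt (𝓡 n) q).source :=
    hsymm.continuousAt.eventually ((isOpen_extChartAt_source q).mem_nhds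
      (by rw [← hq]; exact mem_extChartAt_source q))
  have hsrc' : ∀ᶠ z in 𝓝 (φ y), (extChartAt (𝓡 n) q).symm z ∈ (extChartAt (𝓡 n) p).source := by
    rw [hφy]
    exact (contMDiffAt_extChartAt_symm (mem_extChartAt_target q)).continuousAt.eventually
      ((isOpen_extChartAt_source p).mem_nhds (by rwa [extChartAt_to_inv]))
  have hψφ : ψ ∘ φ =ᶠ[𝓝 y] id := by
    filter_upwards [hsrc, (isOpen_extChartAt_target p).mem_nhds hy] with z hz hz'
    simp only [ψ, φ, Function.comp_apply, id]
    rw [(extChartAt (𝓡 n) q).left_inv hz, (extChartAt (𝓡 n) p).right_inv hz']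
  have hφψ : φ ∘ ψ =ᶠ[𝓝 (φ y)] id := by
    filter_upwards [hsrc', (isOpen_extChartAt_target q).mem_nhds
      (hφy ▸ mem_extChartAt_target q)] with z hz hz'
    simp only [ψ, φ, Function.comp_apply, id]
    rw [(extChartAt (𝓡 n) p).left_inv hz, (extChartAt (𝓡 n) q).right_inv hz']
  have hdφ := (hφ.differentiableAt (by simp)).hasFDerivAt
  have hdψ := (hψ.differentiableAt (by simp)).hasFDerivAt
  have h1 : (fderiv ℝ ψ (φ y)).comp (fderiv ℝ φ y) = .id ℝ _ :=
    ((hdψ.comp y hdφ).congr_of_eventuallyEq hψφ.symm).unique (hasFDerivAt_id y)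
  have h2 : (fderiv ℝ φ y).comp (fderiv ℝ ψ (φ y)) = .id ℝ _ := by
    have hdφ' : HasFDerivAt φ (fderiv ℝ φ y) (ψ (φ y)) := by rwa [hψy]
    exact ((hdφ'.comp _ hdψ).congr_of_eventuallyEq hφψ.symm).unique (hasFDerivAt_id _)
  refine ⟨φ, ContinuousLinearEquiv.equivOfInverse (fderiv ℝ φ y) (fderiv ℝ ψ (φ y))
    (fun v => congrArg (fun T : EuclideanSpace ℝ (Fin n) →L[ℝ] _ => T v) h1)
    (fun v => congrArg (fun T : EuclideanSpace ℝ (Fin n) →L[ℝ] _ => T v) h2),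
    hφy, hφ, rfl, fun f => ?_⟩
  filter_upwards [hsrc] with z hz
  simp only [localRep, φ, Function.comp_apply]
  rw [(extChartAt (𝓡 n) q).left_inv hz]

variable [NormedAddCommGroup V] [InnerProductSpace ℝ V]

theorem diff_eq_fderiv_localRep {ξ : M → V} {x : M}
    (h : MDifferentiableAt (𝓡 n) 𝓘(ℝ, V) ξ x) (u : TangentSpace (𝓡 n) x) :
    diff n ξ x u = fderiv ℝ (localRep (n := n) ξ x) (extChartAt (𝓡 n) x x) u := by
  rw [diff, h.mfderiv, (𝓡 n).range_eq_univ, fderivWithin_univ]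
  rfl

theorem contDiffAt_localRep [IsManifold (𝓡 n) ∞ M] {f : M → V} {p : M}
    {y : EuclideanSpace ℝ (Fin n)} (hy : y ∈ (extChartAt (𝓡 n) p).target)
    (hf : ContMDiffAt (𝓡 n) 𝓘(ℝ, V) ∞ f ((extChartAt (𝓡 n) p).symm y)) :
    ContDiffAt ℝ ∞ (localRep (n := n) f p) y :=
  (hf.comp y (contMDiffAt_extChartAt_symm hy)).contDiffAt

end Charts

/-! ### The normal form at a point -/

section NormalForm
variable {n m : ℕ} {M : Type*} [TopologicalSpace M] [ChartedSpace (EuclideanSpace ℝ (Fin n)) M]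
  {V : Type*} [NormedAddCommGroup V] [InnerProductSpace ℝ V]

theorem range_diff_eq {f : M → V} {x : M} (hf : MDifferentiableAt (𝓡 n) 𝓘(ℝ, V) f x) :
    LinearMap.range (diff n f x).toLinearMap =
      LinearMap.range (fderiv ℝ (localRep (n := n) f x) (extChartAt (𝓡 n) x x)).toLinearMap := by
  ext w
  exact exists_congr fun u => by
    rw [ContinuousLinearMap.coe_coe, diff_eq_fderiv_localRep hf]; rfl

theorem finrank_range_diff
    [Bundle.RiemannianBundle (fun x : M => TangentSpace (𝓡 n) x)]
    {f : M → V} (hf : IsIsometricImmersion n f) (x : M) :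
    Module.finrank ℝ (LinearMap.range (diff n f x).toLinearMap) = n := by
  have hinj : Function.Injective (diff n f x).toLinearMap := by
    rw [← LinearMap.ker_eq_bot, LinearMap.ker_eq_bot']
    intro u hu
    have hu' : diff n f x u = 0 := hu
    have := hf.2 x u u
    rw [hu', inner_zero_left] at this
    exact inner_self_eq_zero.1 this.symm
  rw [LinearMap.finrank_range_of_inj hinj]
  exact finrank_euclideanSpace_fin

variable [FiniteDimensional ℝ V]

theorem normalProj_mem (f : M → V) (x : M) (w : V) : normalProj n f x w ∈ normalSpace n f x :=
  Submodule.starProjection_apply_mem _ _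

theorem sub_normalProj_mem_range (f : M → V) (x : M) (w : V) :
    w - normalProj n f x w ∈ LinearMap.range (diff n f x).toLinearMap := by
  have h := Submodule.sub_starProjection_mem_orthogonal (K := normalSpace n f x) w
  rwa [normalSpace, Submodule.orthogonal_orthogonal] at h

theorem sff_mem_normalSpace (f : M → V) (x : M) (u v : TangentSpace (𝓡 n) x) :
    sff n f x u v ∈ normalSpace n f x := normalProj_mem f x _

theorem firstNormal_le_normalSpace (f : M → V) (x : M) :
    firstNormal n f x ≤ normalSpace n f x := by
  refine Submodule.span_le.2 ?_
  rintro _ ⟨u, v, rfl⟩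
  exact sff_mem_normalSpace f x u v

theorem normalProj_eq_self {f : M → V} {x : M} {w : V} (hw : w ∈ normalSpace n f x) :
    normalProj n f x w = w := Submodule.starProjection_eq_self_iff.2 hw

theorem normalProj_eq_zero {f : M → V} {x : M} {w : V}
    (hw : w ∈ LinearMap.range (diff n f x).toLinearMap) : normalProj n f x w = 0 := by
  rw [normalProj, Submodule.starProjection_apply_eq_zero_iff, normalSpace,
    Submodule.orthogonal_orthogonal]
  exact hw

/-- At the base point of a chart, the second osculating space is the sum of the tangent space and
the first normal space. -/
theorem osculating_localRep_self {f : M → V} {x : M}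
    (hf : MDifferentiableAt (𝓡 n) 𝓘(ℝ, V) f x) :
    osculating (localRep (n := n) f x) (extChartAt (𝓡 n) x x) =
      LinearMap.range (diff n f x).toLinearMap ⊔ firstNormal n f x := by
  rw [osculating, ← range_diff_eq hf]
  refine le_antisymm (sup_le le_sup_left (Submodule.span_le.2 ?_))
    (sup_le le_sup_left (Submodule.span_le.2 ?_))
  · rintro _ ⟨u, v, rfl⟩
    rw [← sub_add_cancel (fderiv ℝ (fderiv ℝ (localRep (n := n) f x))
      (extChartAt (𝓡 n) x x) u v) (normalProj n f x _)]
    exact add_mem (Submodule.mem_sup_left (sub_normalProj_mem_range f x _))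
      (Submodule.mem_sup_right (Submodule.subset_span ⟨u, v, rfl⟩))
  · rintro _ ⟨u, v, rfl⟩
    rw [sff, ← sub_sub_cancel (fderiv ℝ (fderiv ℝ (f ∘ (extChartAt (𝓡 n) x).symm))
        (extChartAt (𝓡 n) x x) u v) (normalProj n f x _)]
    exact sub_mem (Submodule.mem_sup_right (Submodule.subset_span ⟨u, v, rfl⟩))
      (Submodule.mem_sup_left (sub_normalProj_mem_range f x _))

/-- The second fundamental form as a bilinear map. -/
noncomputable def sffₗ (f : M → V) (x : M) :
    TangentSpace (𝓡 n) x →ₗ[ℝ] TangentSpace (𝓡 n) x →ₗ[ℝ] V :=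
  LinearMap.mk₂ ℝ (sff n f x)
    (fun u u' v => by
      refine (congrArg (normalProj n f x) ?_).trans (map_add _ _ _)
      exact congrArg (fun T : EuclideanSpace ℝ (Fin n) →L[ℝ] V => T v) (map_add _ _ _))
    (fun c u v => by
      refine (congrArg (normalProj n f x) ?_).trans (map_smul _ _ _)
      exact congrArg (fun T : EuclideanSpace ℝ (Fin n) →L[ℝ] V => T v) (map_smul _ _ _))
    (fun u v v' => (congrArg (normalProj n f x) (map_add _ _ _)).trans (map_add _ _ _))
    (fun c u v => (congrArg (normalProj n f x) (map_smul _ _ _)).trans (map_smul _ _ _))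

variable [Bundle.RiemannianBundle (fun x : M => TangentSpace (𝓡 n) x)]

/-- The values of the second fundamental form on a basis, expressed through two independent normal
vectors: with `γ₂ = 0` only `η₁` and `η₂` contribute to the normal form. -/
theorem exists_sff_eq_of_form (hm : 2 ≤ m) {f : M → V} {x : M} {μ γ : ℝ}
    (h : HasWintgenForm n m f x μ γ 0) :
    ∃ (e : OrthonormalBasis (Fin n) ℝ (TangentSpace (𝓡 n) x)) (η₁ η₂ : V),
      LinearIndependent ℝ ![η₁, η₂] ∧ ∀ i j, sff n f x (e i) (e j) =
        wintgenMatrix n μ γ 0 0 i j • η₁ + wintgenMatrix n μ γ 0 1 i j • η₂ := by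
  obtain ⟨e, η, h⟩ := h
  have hne : (⟨0, by omega⟩ : Fin m) ≠ ⟨1, by omega⟩ := by simp
  refine ⟨e, η ⟨0, by omega⟩, η ⟨1, by omega⟩, ?_, fun i j => ?_⟩
  · have hli : LinearIndependent ℝ fun a => (η a : V) :=
      (η.orthonormal.comp_linearIsometry (normalSpace n f x).subtypeₗᵢ).linearIndependent
    have := hli.comp ![(⟨0, by omega⟩ : Fin m), ⟨1, by omega⟩] (by
      intro a b hab
      fin_cases a <;> fin_cases b <;> simp at hab ⊢)
    convert this using 1
    ext a
    fin_cases a <;> rfl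
  · have hs := congrArg Subtype.val (η.sum_repr' ⟨_, sff_mem_normalSpace f x (e i) (e j)⟩)
    rw [Fintype.sum_eq_add ⟨0, by omega⟩ ⟨1, by omega⟩ hne] at hs
    · refine hs.symm.trans ?_
      simp only [Submodule.coe_add, Submodule.coe_smul, Submodule.coe_inner]
      rw [real_inner_comm, h, real_inner_comm, h]
    · rintro ⟨a, ha⟩ ⟨h0, h1⟩
      simp only [Submodule.coe_inner]
      rw [real_inner_comm, h]
      match a with
      | 0 => simp at h0
      | 1 => simp at h1
      | 2 => simp [wintgenMatrix]
      | a + 3 => simp [wintgenMatrix]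

theorem finrank_firstNormal_of_form (hn : 2 ≤ n) (hm : 2 ≤ m) {f : M → V} {x : M} {μ γ : ℝ}
    (hμ : μ ≠ 0) (h : HasWintgenForm n m f x μ γ 0) :
    Module.finrank ℝ (firstNormal n f x) = 2 := by
  obtain ⟨e, η₁, η₂, hli, h⟩ := exists_sff_eq_of_form hm h
  suffices hs : firstNormal n f x = Submodule.span ℝ (Set.range ![η₁, η₂]) by
    rw [hs, finrank_span_eq_card hli, Fintype.card_fin]
  have h1 : η₁ ∈ Submodule.span ℝ (Set.range ![η₁, η₂]) := Submodule.subset_span ⟨0, rfl⟩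
  have h2 : η₂ ∈ Submodule.span ℝ (Set.range ![η₁, η₂]) := Submodule.subset_span ⟨1, rfl⟩
  apply le_antisymm
  · refine Submodule.span_le.2 ?_
    rintro _ ⟨u, v, rfl⟩
    let S := Submodule.span ℝ (Set.range ![η₁, η₂])
    have hb : (sffₗ f x).compr₂ S.mkQ = 0 :=
      e.toBasis.ext fun i => e.toBasis.ext fun j => by
        refine (Submodule.Quotient.mk_eq_zero S).2 ?_
        have hij : sff n f x (e i) (e j) ∈ S :=
          (h i j).symm ▸ add_mem (S.smul_mem _ h1) (S.smul_mem _ h2)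
        rw [OrthonormalBasis.coe_toBasis]
        exact hij
    exact (Submodule.Quotient.mk_eq_zero S).1 (LinearMap.congr_fun (LinearMap.congr_fun hb u) v)
  · have hsff : ∀ u v, sff n f x u v ∈ firstNormal n f x := fun u v =>
      Submodule.subset_span ⟨u, v, rfl⟩
    have k2 : η₂ ∈ firstNormal n f x := by
      have := hsff (e ⟨0, by omega⟩) (e ⟨1, by omega⟩)
      rw [h] at this
      simpa [wintgenMatrix, Submodule.smul_mem_iff _ hμ] using this
    have k1 : η₁ ∈ firstNormal n f x := by
      have := hsff (e ⟨0, by omega⟩) (e ⟨0, by omega⟩)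
      rw [h, Submodule.add_mem_iff_left _ (Submodule.smul_mem _ _ k2)] at this
      simpa [wintgenMatrix, Submodule.smul_mem_iff _ hμ] using this
    refine Submodule.span_le.2 ?_
    rintro _ ⟨a, rfl⟩
    fin_cases a
    · exact k1
    · exact k2

theorem hasWintgenHessian_localRep_self (hm : 2 ≤ m) {f : M → V} {x : M} {μ γ : ℝ}
    (hf : MDifferentiableAt (𝓡 n) 𝓘(ℝ, V) f x) (hμ : μ ≠ 0) (hγ : γ ≠ 0)
    (h : HasWintgenForm n m f x μ γ 0) :
    HasWintgenHessian n (localRep (n := n) f x) (extChartAt (𝓡 n) x x) := by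
  obtain ⟨e, η₁, η₂, -, h⟩ := exists_sff_eq_of_form hm h
  refine ⟨μ, γ, (e.toBasis : Module.Basis (Fin n) ℝ (TangentSpace (𝓡 n) x)), η₁, η₂, hμ, hγ,
    fun i j => ?_⟩
  rw [← h, ← range_diff_eq hf, ← e.coe_toBasis]
  exact sub_normalProj_mem_range f x _

end NormalForm

/-! ### Parallelism of the first normal spaces -/

section Parallel
variable {n m : ℕ} {M : Type*} [TopologicalSpace M]
  [ChartedSpace (EuclideanSpace ℝ (Fin n)) M] [IsManifold (𝓡 n) ∞ M]
  {V : Type*} [NormedAddCommGroup V] [InnerProductSpace ℝ V] [FiniteDimensional ℝ V]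

/-- In any chart, the second osculating space is the sum of the tangent space and the first normal
space. -/
theorem osculating_localRep {f : M → V} (hf : ContMDiff (𝓡 n) 𝓘(ℝ, V) ∞ f) {p : M}
    {y : EuclideanSpace ℝ (Fin n)} (hy : y ∈ (extChartAt (𝓡 n) p).target) :
    osculating (localRep (n := n) f p) y =
      LinearMap.range (diff n f ((extChartAt (𝓡 n) p).symm y)).toLinearMap ⊔
        firstNormal n f ((extChartAt (𝓡 n) p).symm y) := by
  obtain ⟨φ, A, hφy, hφ, hA, hrep⟩ := exists_coordinate_change p hy _ rfl
  have hG := contDiffAt_localRep (mem_extChartAt_target (I := 𝓡 n) ((extChartAt (𝓡 n) p).symm y))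
    hf.contMDiffAt
  rw [← osculating_localRep_self ((hf _).mdifferentiableAt (by simp)), ← hφy]
  exact osculating_comp (hφy ▸ hG) hφ (hrep f) A hA

variable [Bundle.RiemannianBundle (fun x : M => TangentSpace (𝓡 n) x)]

theorem hasWintgenHessian_localRep (hm : 2 ≤ m) {f : M → V}
    (hf : ContMDiff (𝓡 n) 𝓘(ℝ, V) ∞ f) {p : M} {y : EuclideanSpace ℝ (Fin n)}
    (hy : y ∈ (extChartAt (𝓡 n) p).target) {μ γ : ℝ} (hμ : μ ≠ 0) (hγ : γ ≠ 0)
    (h : HasWintgenForm n m f ((extChartAt (𝓡 n) p).symm y) μ γ 0) :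
    HasWintgenHessian n (localRep (n := n) f p) y := by
  obtain ⟨φ, A, hφy, hφ, hA, hrep⟩ := exists_coordinate_change p hy _ rfl
  have hG := contDiffAt_localRep (mem_extChartAt_target (I := 𝓡 n) ((extChartAt (𝓡 n) p).symm y))
    hf.contMDiffAt
  have hH := hasWintgenHessian_localRep_self hm ((hf _).mdifferentiableAt (by simp)) hμ hγ h
  exact HasWintgenHessian.comp (hφy ▸ hG) hφ (hrep f) A hA (hφy ▸ hH)

theorem finrank_osculating_localRep (hn : 2 ≤ n) (hm : 2 ≤ m) {f : M → V}
    (hf : IsIsometricImmersion n f) {p : M} {y : EuclideanSpace ℝ (Fin n)}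
    (hy : y ∈ (extChartAt (𝓡 n) p).target) {μ γ : ℝ} (hμ : μ ≠ 0)
    (h : HasWintgenForm n m f ((extChartAt (𝓡 n) p).symm y) μ γ 0) :
    Module.finrank ℝ (osculating (localRep (n := n) f p) y) = n + 2 := by
  have hdisj : LinearMap.range (diff n f ((extChartAt (𝓡 n) p).symm y)).toLinearMap ⊓
      firstNormal n f ((extChartAt (𝓡 n) p).symm y) = ⊥ :=
    ((Submodule.orthogonal_disjoint _).mono_right (firstNormal_le_normalSpace f _)).eq_bot
  have h1 := Submodule.finrank_sup_add_finrank_inf_eq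
    (LinearMap.range (diff n f ((extChartAt (𝓡 n) p).symm y)).toLinearMap)
    (firstNormal n f ((extChartAt (𝓡 n) p).symm y))
  rw [hdisj, finrank_bot, finrank_range_diff hf, finrank_firstNormal_of_form hn hm hμ h] at h1
  rw [osculating_localRep hf.1 hy]
  exact h1

/-- In a chart, near the base point, a submanifold with `μ ≠ 0`, `γ₁ ≠ 0` and `γ₂ = 0` has the
properties that make its second osculating spaces locally constant. -/
theorem eventually_localRep (hn : 2 ≤ n) (hm : 2 ≤ m) {f : M → V}
    (hf : IsIsometricImmersion n f) {μ γ : M → ℝ}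
    (hform : ∀ x, HasWintgenForm n m f x (μ x) (γ x) 0) (hμ : ∀ x, μ x ≠ 0) (hγ : ∀ x, γ x ≠ 0)
    (p : M) : ∀ᶠ z in 𝓝 (extChartAt (𝓡 n) p p), ContDiffAt ℝ ∞ (localRep (n := n) f p) z ∧
      HasWintgenHessian n (localRep (n := n) f p) z ∧
      Module.finrank ℝ (osculating (localRep (n := n) f p) z) =
        Module.finrank ℝ (osculating (localRep (n := n) f p) (extChartAt (𝓡 n) p p)) := by
  filter_upwards [extChartAt_target_mem_nhds (I := 𝓡 n) p] with z hz
  refine ⟨contDiffAt_localRep hz hf.1.contMDiffAt,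
    hasWintgenHessian_localRep hm hf.1 hz (hμ _) (hγ _) (hform _), ?_⟩
  rw [finrank_osculating_localRep hn hm hf hz (hμ _) (hform _),
    finrank_osculating_localRep hn hm hf (mem_extChartAt_target p) (hμ _) (hform _)]

theorem firstNormalParallel_of_form (hn : 3 ≤ n) (hm : 2 ≤ m) {f : M → V}
    (hf : IsIsometricImmersion n f) {μ γ : M → ℝ}
    (hform : ∀ x, HasWintgenForm n m f x (μ x) (γ x) 0) (hμ : ∀ x, μ x ≠ 0)
    (hγ : ∀ x, γ x ≠ 0) : FirstNormalParallel n f := by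
  intro U ξ hU hξ hξN x hx u
  have hloc := eventually_localRep (by omega) hm hf hform hμ hγ x
  obtain ⟨hF, hH, -⟩ := hloc.self_of_nhds
  have hξx : ContMDiffAt (𝓡 n) 𝓘(ℝ, V) ∞ ξ x := hξ.contMDiffAt (hU.mem_nhds hx)
  have hσ : ContDiffAt ℝ ∞ (localRep (n := n) ξ x) (extChartAt (𝓡 n) x x) :=
    contDiffAt_localRep (mem_extChartAt_target x) (by rwa [extChartAt_to_inv])
  have hσO : ∀ᶠ z in 𝓝 (extChartAt (𝓡 n) x x),
      localRep (n := n) ξ x z ∈ osculating (localRep (n := n) f x) z := by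
    have hUz : ∀ᶠ z in 𝓝 (extChartAt (𝓡 n) x x), (extChartAt (𝓡 n) x).symm z ∈ U :=
      (contMDiffAt_extChartAt_symm (mem_extChartAt_target x)).continuousAt.eventually
        (hU.mem_nhds (by rwa [extChartAt_to_inv]))
    filter_upwards [hUz, extChartAt_target_mem_nhds (I := 𝓡 n) x] with z hzU hz
    rw [osculating_localRep hf.1 hz]
    exact Submodule.mem_sup_right (hξN _ hzU)
  have hmem : diff n ξ x u ∈ osculating (localRep (n := n) f x) (extChartAt (𝓡 n) x x) := by
    rw [diff_eq_fderiv_localRep (hξx.mdifferentiableAt (by simp))]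
    exact fderiv_section_mem_osculating hn hF (hloc.mono fun z hz => hz.2.2) hH
      (hσ.differentiableAt (by simp)) hσO u
  rw [osculating_localRep_self ((hf.1 x).mdifferentiableAt (by simp))] at hmem
  obtain ⟨t, ht, ν, hν, htν⟩ := Submodule.mem_sup.1 hmem
  rw [normalDeriv, ← htν, map_add, normalProj_eq_zero ht,
    normalProj_eq_self (firstNormal_le_normalSpace f x hν), zero_add]
  exact hν

/-- Every point has a neighbourhood that is mapped into the affine space through the second
osculating space. -/
theorem exists_isOpen_image_subset (hn : 3 ≤ n) (hm : 2 ≤ m) {f : M → V}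
    (hf : IsIsometricImmersion n f) {μ γ : M → ℝ}
    (hform : ∀ x, HasWintgenForm n m f x (μ x) (γ x) 0) (hμ : ∀ x, μ x ≠ 0)
    (hγ : ∀ x, γ x ≠ 0) (x : M) : ∃ U : Set M, IsOpen U ∧ x ∈ U ∧ f '' U ⊆
      AffineSubspace.mk' (f x) (osculating (localRep (n := n) f x) (extChartAt (𝓡 n) x x)) := by
  have hloc := eventually_localRep (by omega) hm hf hform hμ hγ x
  have hsub := eventually_sub_mem_of_osculating_eq
    (hloc.mono fun z hz => hz.1.differentiableAt (by simp)) (eventually_osculating_eq hn hloc)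
  have hM : ∀ᶠ q in 𝓝 x, f q - f x ∈
      osculating (localRep (n := n) f x) (extChartAt (𝓡 n) x x) := by
    filter_upwards [(continuousAt_extChartAt (I := 𝓡 n) x).eventually hsub,
      extChartAt_source_mem_nhds (I := 𝓡 n) x] with q hq hqs
    simpa only [localRep, Function.comp_apply, (extChartAt (𝓡 n) x).left_inv hqs,
      extChartAt_to_inv] using hq
  obtain ⟨U, hU, hUo, hxU⟩ := eventually_nhds_iff.1 hM
  refine ⟨U, hUo, hxU, ?_⟩
  rintro _ ⟨q, hq, rfl⟩
  exact AffineSubspace.mem_mk'.2 (hU q hq)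

end Parallel

end WintgenIdeal

theorem mainTheorem5 {n m : ℕ} (hn : 3 ≤ n) (hm : 2 ≤ m)
    {M : Type*} [TopologicalSpace M] [Nonempty M]
    [ChartedSpace (EuclideanSpace ℝ (Fin n)) M] [IsManifold (𝓡 n) ∞ M]
    [Bundle.RiemannianBundle (fun x : M => TangentSpace (𝓡 n) x)]
    [IsContMDiffRiemannianBundle (𝓡 n) ∞ (EuclideanSpace ℝ (Fin n))
      (fun x : M => TangentSpace (𝓡 n) x)]
    (f : M → EuclideanSpace ℝ (Fin (n + m)))
    (hf : WintgenIdeal.IsIsometricImmersion n f)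
    (hW : WintgenIdeal.IsWintgenIdeal n f)
    (μ γ₁ γ₂ : M → ℝ)
    (hform : ∀ x : M, WintgenIdeal.HasWintgenForm n m f x (μ x) (γ₁ x) (γ₂ x))
    (hμ : ∀ x : M, μ x ≠ 0)
    (hγ₁ : ∀ x : M, γ₁ x ≠ 0)
    (hγ₂ : ∀ x : M, γ₂ x = 0) :
    (∀ x : M, Module.finrank ℝ (WintgenIdeal.firstNormal n f x) = 2) ∧
      WintgenIdeal.FirstNormalParallel n f ∧
      (WintgenIdeal.LocallySubstantial f → m = 2) := by
  have hform₀ : ∀ x, WintgenIdeal.HasWintgenForm n m f x (μ x) (γ₁ x) 0 := fun x => by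
    simpa only [hγ₂ x] using hform x
  refine ⟨fun x => WintgenIdeal.finrank_firstNormal_of_form (by omega) hm (hμ x) (hform₀ x),
    WintgenIdeal.firstNormalParallel_of_form hn hm hf hform₀ hμ hγ₁, fun hsub => ?_⟩
  obtain ⟨x⟩ := ‹Nonempty M›
  obtain ⟨U, hUo, hxU, hU⟩ :=
    WintgenIdeal.exists_isOpen_image_subset hn hm hf hform₀ hμ hγ₁ x
  have htop := congrArg AffineSubspace.direction (hsub U hUo ⟨x, hxU⟩ _ hU)
  rw [AffineSubspace.direction_mk', AffineSubspace.direction_top] at htop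
  have hrank := WintgenIdeal.finrank_osculating_localRep (by omega) hm hf
    (mem_extChartAt_target (I := 𝓡 n) x) (hμ _) (hform₀ _)
  rw [htop, finrank_top, finrank_euclideanSpace_fin] at hrank
  omega
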